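/- For a set $X$ let $L^+X=\coprod_{n>0}X^n$ be the set of non-empty lists $[x_1,\dots,x_n]$ of elements of $X$, and for $f\colon X\to Y$ let $L^+f[x_1,\dots,x_n]=[f(x_1),\dots,f(x_n)]$. The endofunctor $L^+$ of $\mathbf{Set}$ is a monad $\mathbb L^+$ with multiplication $\mu_X\colon L^+L^+X\to L^+X$ the concatenation of a list of lists and unit $\eta_X(x)=[x]$, and a comonad $\mathbb C$ with comultiplication $\Delta_X[x_1,\dots,x_n]=[[x_1,\dots,x_n],[x_2,\dots,x_n],\dots,[x_n]]$ and counit $\varepsilon_X[x_1,\dots,x_n]=x_1$. The mixed distributive law $\theta\colon \mathbb L^+\mathbb C\Rightarrow\mathbb C\mathbb L^+$ sends a list of lists $[[x_{1,1},\dots,x_{1,n_1}],\dots,[x_{m,1},\dots,x_{m,n_m}]]$ to the list of all lists $[x_{i,j},x_{i+1,1},x_{i+2,1},\dots,x_{m,1}]$ with $1\le i\le m$ and $1\le j\le n_i$, the pairs $(i,j)$ being taken in lexicographic order. With these data $L^+$ is a bimonad (in the sense of Mesablishvili and Wisbauer), the non-empty list bimonad. Let $\mathbf{Sgp}=\mathbf{Set}^{\mathbb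 L^+}$ be the Eilenberg--Moore category of the monad $\mathbb L^+$ (which is isomorphic to the category of semigroups), and let $\mathbb C^\theta$ be the lift of the comonad $\mathbb C$ to $\mathbf{Sgp}$, given by $C^\theta(X,\alpha)=(L^+X,\,L^+(\alpha)\circ\theta_X)$ and $C^\theta(f)=L^+(f)$, with $\Delta^{\mathbb C^\theta}_{(X,\alpha)}=\Delta_X$ and $\varepsilon^{\mathbb C^\theta}_{(X,\alpha)}=\varepsilon_X$. Let $\mathbf{Sgp}_{\mathbb C^\theta}$ be the category of $\mathbb C^\theta$-coalgebras, and let $$K\colon\mathbf{Set}\to\mathbf{Sgp}_{\mathbb C^\theta},\qquad K(X)=((L^+X,\mu_X),\Delta_X),\qquad K(f)=L^+(f).$$ Then $K$ is not an equivalence of categories. Consequently the hypotheses of the conjugate classification, namely that $\theta$ is invertible and that the comparison functor $K$ is an equivalence, are not both satisfied by the non-empty list bimonad. -/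

import Mathlib

open CategoryTheory

universe v u

/-- A mixed distributive law `θ : B C ⇒ C B` of a monad `B` over a comonad `C`
(note that `F ⋙ G` is the composite "first `F`, then `G`"): `(C, θ)` is a lax endomorphism of the
monad `B` and `(B, θ)` is a colax endomorphism of the comonad `C`. -/
structure MixedDistributiveLaw {A : Type u} [Category.{v} A] (B : Monad A) (C : Comonad A) where
  θ : C.toFunctor ⋙ B.toFunctor ⟶ B.toFunctor ⋙ C.toFunctor
  mul : ∀ X : A, B.μ.app (C.obj X) ≫ θ.app X =
    B.map (θ.app X) ≫ θ.app (B.obj X) ≫ C.map (B.μ.app X)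
  unit : ∀ X : A, B.η.app (C.obj X) ≫ θ.app X = C.map (B.η.app X)
  comul : ∀ X : A, θ.app X ≫ C.δ.app (B.obj X) =
    B.map (C.δ.app X) ≫ θ.app (C.obj X) ≫ C.map (θ.app X)
  counit : ∀ X : A, θ.app X ≫ C.ε.app (B.obj X) = B.map (C.ε.app X)

namespace MixedDistributiveLaw

variable {A : Type u} [Category.{v} A] {B : Monad A} {C : Comonad A}

/-- The functor `C^θ` on the Eilenberg–Moore category of `B`:
`C^θ (X, α) = (C X, C α ∘ θ_X)` and `C^θ f = C f`. -/
def liftFunctor (t : MixedDistributiveLaw B C) : B.Algebra ⥤ B.Algebra where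
  obj M :=
    { A := C.obj M.A
      a := t.θ.app M.A ≫ C.map M.a
      unit := by
        rw [← Category.assoc, t.unit, ← C.map_comp, M.unit]
        exact C.map_id _
      assoc := by
        have h := t.θ.naturality M.a
        simp only [Functor.comp_map] at h
        rw [← Category.assoc, t.mul, Functor.map_comp, Category.assoc, Category.assoc,
          Category.assoc, ← C.map_comp, M.assoc, C.map_comp, reassoc_of% h] }
  map {M N} f :=
    { f := C.map f.f
      h := by
        have h := t.θ.naturality f.f
        simp only [Functor.comp_map] at h
        change B.map (C.map f.f) ≫ t.θ.app N.A ≫ C.map N.a =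
          (t.θ.app M.A ≫ C.map M.a) ≫ C.map f.f
        rw [reassoc_of% h, ← C.map_comp, f.h, C.map_comp, Category.assoc] }
  map_id M := by ext; exact C.map_id _
  map_comp f g := by ext; exact C.map_comp _ _

/-- The lift `C^θ` of the comonad `C` to the Eilenberg–Moore category of the monad `B`, whose
comultiplication and counit at `(X, α)` are those of `C` at `X`. -/
def lift (t : MixedDistributiveLaw B C) : Comonad B.Algebra where
  toFunctor := t.liftFunctor
  ε :=
    { app := fun M =>
        { f := C.ε.app M.A
          h := by
            have h := C.ε.naturality M.a
            simp only [Functor.id_map] at h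
            change B.map (C.ε.app M.A) ≫ M.a = (t.θ.app M.A ≫ C.map M.a) ≫ C.ε.app M.A
            rw [Category.assoc, h, ← t.counit, Category.assoc] }
      naturality := fun M N f => by ext; exact C.ε.naturality f.f }
  δ :=
    { app := fun M =>
        { f := C.δ.app M.A
          h := by
            have h := C.δ.naturality M.a
            have h' := t.θ.naturality M.a
            simp only [Functor.comp_map] at h h'
            change B.map (C.δ.app M.A) ≫ t.θ.app (C.obj M.A) ≫ C.map (t.θ.app M.A ≫ C.map M.a) =
              (t.θ.app M.A ≫ C.map M.a) ≫ C.δ.app M.A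
            rw [Category.assoc, h, ← Category.assoc (t.θ.app M.A), t.comul, C.map_comp]
            simp only [Category.assoc] }
      naturality := fun M N f => by ext; exact C.δ.naturality f.f }
  coassoc M := by ext; exact C.coassoc M.A
  left_counit M := by ext; exact C.left_counit M.A
  right_counit M := by ext; exact C.right_counit M.A

end MixedDistributiveLaw

/-- A bimonad in the sense of Mesablishvili and Wisbauer: a monad and a comonad with the same
underlying endofunctor, together with a compatible mixed distributive law. -/
structure Bimonad (A : Type u) [Category.{v} A] extends CategoryTheory.Monad A,
    CategoryTheory.Comonad A where
  law : MixedDistributiveLaw toMonad toComonad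
  counit_mul : ∀ X : A, μ.app X ≫ ε.app X = ε.app (toFunctor.obj X) ≫ ε.app X
  unit_comul : ∀ X : A, η.app X ≫ δ.app X = η.app X ≫ η.app (toFunctor.obj X)
  unit_counit : ∀ X : A, η.app X ≫ ε.app X = 𝟙 X
  mul_comul : ∀ X : A, μ.app X ≫ δ.app X =
    toFunctor.map (δ.app X) ≫ law.θ.app (toFunctor.obj X) ≫ toFunctor.map (μ.app X)

namespace Bimonad

variable {A : Type u} [Category.{v} A]

/-- The category `(A^B)_{C^θ}` of entwined coalgebras: coalgebras over the lifted comonad `C^θ` on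
the Eilenberg–Moore category of the monad `B`. -/
abbrev EntwinedCoalgebra (B : Bimonad A) : Type max u v := B.law.lift.Coalgebra

/-- The comparison functor `K : A ⥤ (A^B)_{C^θ}`, `K X = (F X, Δ_X) = ((B X, μ_X), Δ_X)` and
`K f = F f`, where `F` is the free `B`-algebra functor. -/
def comparison (B : Bimonad A) : A ⥤ B.EntwinedCoalgebra where
  obj X :=
    { A := B.toMonad.free.obj X
      a :=
        { f := B.δ.app X
          h := by
            change B.map (B.δ.app X) ≫ B.law.θ.app (B.obj X) ≫ B.map (B.μ.app X) =
              B.μ.app X ≫ B.δ.app X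
            exact (B.mul_comul X).symm }
      counit := by ext; exact B.left_counit X
      coassoc := by ext; exact (B.coassoc X).symm }
  map f :=
    { f := B.toMonad.free.map f
      h := by ext; exact (B.δ.naturality f).symm }
  map_id X := by ext; exact B.map_id X
  map_comp f g := by ext; exact B.map_comp f g

/-- The hypotheses under which the conjugate classification (of left `χ`-coalgebras on a functor
`N` by opcoalgebras on `N F` over the comonad on `A` conjugate to `T^θ` along `K`) applies to the
bimonad: `θ` is invertible and `K` is an equivalence. -/
def ConjugateClassificationApplies (B : Bimonad A) : Prop :=
  IsIso B.law.θ ∧ B.comparison.IsEquivalence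

end Bimonad

/-- Non-empty lists: `single x` is `[x]` and `cons x [x₁, …, xₙ]` is `[x, x₁, …, xₙ]`. -/
inductive NEList (X : Type u) : Type u
  | single (x : X) : NEList X
  | cons (x : X) (l : NEList X) : NEList X

namespace NEList

variable {X Y Z : Type u}

/-- Concatenation of two lists. -/
def append : NEList X → NEList X → NEList X
  | single x, m => cons x m
  | cons x l, m => cons x (append l m)

/-- `[x₁, …, xₙ] ↦ [f x₁, …, f xₙ]`. -/
def map (f : X → Y) : NEList X → NEList Y
  | single x => single (f x)
  | cons x l => cons (f x) (map f l)

/-- Concatenation of a list of lists. -/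
def flatten : NEList (NEList X) → NEList X
  | single l => l
  | cons l L => append l (flatten L)

/-- `[x₁, …, xₙ] ↦ x₁`. -/
def head : NEList X → X
  | single x => x
  | cons x _ => x

/-- `[x₁, …, xₙ] ↦ [[x₁, …, xₙ], [x₂, …, xₙ], …, [xₙ]]`. -/
def tails : NEList X → NEList (NEList X)
  | single x => single (single x)
  | cons x l => cons (cons x l) (tails l)

/-- The list of lists `[[x₁₁, …], …, [xₘ₁, …]]` is sent to the list of all
`[xᵢⱼ, xᵢ₊₁,₁, xᵢ₊₂,₁, …, xₘ₁]`, with the pairs `(i, j)` in lexicographic order. -/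
def theta : NEList (NEList X) → NEList (NEList X)
  | single l => map single l
  | cons l L => append (map (fun x => cons x (map head L)) l) (theta L)

theorem append_assoc (l m k : NEList X) : append (append l m) k = append l (append m k) := by
  induction l with
  | single x => rfl
  | cons x l ih => simp only [append, ih]

theorem map_append (f : X → Y) (l m : NEList X) :
    map f (append l m) = append (map f l) (map f m) := by
  induction l with
  | single x => rfl
  | cons x l ih => simp only [append, map, ih]

theorem map_id' (l : NEList X) : map (fun x => x) l = l := by
  induction l with
  | single x => rfl
  | cons x l ih => simp only [map, ih]

theorem map_map (g : Y → Z) (f : X → Y) (l : NEList X) :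
    map g (map f l) = map (fun x => g (f x)) l := by
  induction l with
  | single x => rfl
  | cons x l ih => simp only [map, ih]

theorem head_map (f : X → Y) (l : NEList X) : head (map f l) = f (head l) := by
  cases l <;> rfl

theorem head_append (l m : NEList X) : head (append l m) = head l := by
  cases l <;> rfl

theorem head_flatten (L : NEList (NEList X)) : head (flatten L) = head (head L) := by
  cases L with
  | single l => rfl
  | cons l L => exact head_append _ _

theorem head_tails (l : NEList X) : head (tails l) = l := by
  cases l <;> rfl

theorem flatten_append (L M : NEList (NEList X)) :
    flatten (append L M) = append (flatten L) (flatten M) := by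
  induction L with
  | single x => rfl
  | cons x l ih => simp only [append, flatten, ih, append_assoc]

theorem map_flatten (f : X → Y) (L : NEList (NEList X)) :
    map f (flatten L) = flatten (map (map f) L) := by
  induction L with
  | single l => rfl
  | cons l L ih => simp only [map, flatten, map_append, ih]

theorem flatten_flatten (L : NEList (NEList (NEList X))) :
    flatten (map flatten L) = flatten (flatten L) := by
  induction L with
  | single l => rfl
  | cons l L ih => simp only [map, flatten, flatten_append, ih]

theorem flatten_map_single (l : NEList X) : flatten (map single l) = l := by
  induction l with
  | single x => rfl
  | cons x l ih => simp only [map, flatten, append, ih]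

theorem map_tails (f : X → Y) (l : NEList X) : tails (map f l) = map (map f) (tails l) := by
  induction l with
  | single x => rfl
  | cons x l ih => simp only [map, tails, ih]

theorem tails_tails (l : NEList X) : map tails (tails l) = tails (tails l) := by
  induction l with
  | single x => rfl
  | cons x l ih => simp only [map, tails, ih]

theorem map_head_tails (l : NEList X) : map head (tails l) = l := by
  induction l with
  | single x => rfl
  | cons x l ih => simp only [map, tails, head, ih]

theorem map_theta (f : X → Y) (L : NEList (NEList X)) :
    theta (map (map f) L) = map (map f) (theta L) := by
  induction L with
  | single l => simp only [map, theta, map_map]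
  | cons l L ih => simp only [map, theta, map_append, map_map, head_map, ih]

theorem head_theta (L : NEList (NEList X)) : head (theta L) = map head L := by
  cases L with
  | single l => simp only [theta, map, head_map]
  | cons l L => simp only [theta, map, head_append, head_map]

theorem tails_append (l m : NEList X) :
    tails (append l m) = append (map (fun t => append t m) (tails l)) (tails m) := by
  induction l with
  | single x => rfl
  | cons x l ih => simp only [append, tails, map, ih]

theorem tails_flatten (L : NEList (NEList X)) :
    tails (flatten L) = map flatten (theta (map tails L)) := by
  induction L with
  | single l => simp only [flatten, map, theta, map_map, map_id']
  | cons l L ih =>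
    simp only [flatten, map, theta, map_append, map_map, head_tails, map_id', tails_append, ih]

theorem tails_theta (L : NEList (NEList X)) :
    tails (theta L) = map theta (theta (map tails L)) := by
  induction L with
  | single l => simp only [map, theta, map_map, map_tails]
  | cons l L ih =>
    simp only [map, theta, map_append, map_map, head_tails, map_id', tails_append, map_tails, ih]

theorem theta_append (L M : NEList (NEList X)) :
    theta (append L M) =
      append (map (fun t => append t (map head M)) (theta L)) (theta M) := by
  induction L with
  | single l => simp only [append, theta, map_map]
  | cons l L ih => simp only [append, theta, map_append, map_map, ih, append_assoc]

theorem theta_flatten (L : NEList (NEList (NEList X))) :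
    theta (flatten L) = map flatten (theta (map theta L)) := by
  induction L with
  | single l => simp only [flatten, map, theta, map_map, map_id']
  | cons l L ih =>
    simp only [flatten, map, theta, map_append, map_map, theta_append, ih, map_flatten,
      head_theta]

/-- The endofunctor `L⁺` on sets. -/
def functor : Type u ⥤ Type u where
  obj X := NEList X
  map f := ↾(map f)
  map_id X := by ext l; exact map_id' l
  map_comp f g := by ext l; exact (map_map g f l).symm

/-- The non-empty list monad. -/
def monad : CategoryTheory.Monad (Type u) where
  toFunctor := functor
  η := { app := fun X => ↾(single : X → NEList X), naturality := fun X Y f => rfl }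
  μ :=
    { app := fun X => ↾(flatten : NEList (NEList X) → NEList X)
      naturality := fun X Y f => by ext L; exact (map_flatten f L).symm }
  assoc X := by ext L; exact flatten_flatten L
  left_unit X := rfl
  right_unit X := by ext l; exact flatten_map_single l

/-- The non-empty list comonad. -/
def comonad : CategoryTheory.Comonad (Type u) where
  toFunctor := functor
  ε :=
    { app := fun X => ↾(head : NEList X → X)
      naturality := fun X Y f => by ext l; exact head_map f l }
  δ :=
    { app := fun X => ↾(tails : NEList X → NEList (NEList X))
      naturality := fun X Y f => by ext l; exact map_tails f l }
  coassoc X := by ext l; exact tails_tails l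
  left_counit X := by ext l; exact head_tails l
  right_counit X := by ext l; exact map_head_tails l

/-- The mixed distributive law of the non-empty list bimonad. -/
def law : MixedDistributiveLaw monad.{u} comonad.{u} where
  θ :=
    { app := fun X => ↾(theta : NEList (NEList X) → NEList (NEList X))
      naturality := fun X Y f => by ext L; exact map_theta f L }
  mul X := by ext L; exact theta_flatten L
  unit X := rfl
  comul X := by ext L; exact tails_theta L
  counit X := by ext L; exact head_theta L

/-- The non-empty list bimonad `L⁺` on the category of sets. -/
def bimonad : Bimonad (Type u) where
  toMonad := monad
  ε := comonad.ε
  δ := comonad.δ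
  coassoc := comonad.coassoc
  left_counit := comonad.left_counit
  right_counit := comonad.right_counit
  law := law
  counit_mul X := by ext L; exact head_flatten L
  unit_comul X := rfl
  unit_counit X := rfl
  mul_comul X := by ext L; exact tails_flatten L

end NEList

/-! `K` is not essentially surjective. A `C`-coalgebra on a set is a forest, the structure map
listing the path from a node to its root; the `θ`-compatibility with a semigroup says that the path
of `s * t` is the path of `s` multiplied by `t`, followed by the path of `t`. So for a root `r`, the
product `r * t` is a child of `t`, but nothing forces different roots to give different children.
`Tower` has two roots and one child per node, so both roots have the same product with `t`. Free
semigroups are right cancellative (`append_right_cancel`), hence no `K X` is isomorphic to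
`Tower.coalgebra`. The work lies in `path_prod`, which makes the towers an entwined coalgebra. -/

namespace NEList

variable {X : Type u}

/-- The underlying list of a non-empty list. -/
def toList : NEList X → List X
  | single x => [x]
  | cons x l => x :: toList l

theorem toList_append (l m : NEList X) : toList (append l m) = toList l ++ toList m := by
  induction l with
  | single x => rfl
  | cons x l ih => simp only [append, toList, ih, List.cons_append]

theorem toList_injective : Function.Injective (toList : NEList X → List X) := by
  have toList_ne_nil (l : NEList X) : toList l ≠ [] := by cases l <;> simp [toList]
  intro l
  induction l with
  | single x =>
    intro m h
    cases m with
    | single y => simp_all [toList]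
    | cons y m => exact absurd (List.cons.inj h).2.symm (toList_ne_nil m)
  | cons x l ih =>
    intro m h
    cases m with
    | single y => exact absurd (List.cons.inj h).2 (toList_ne_nil l)
    | cons y m => rw [(List.cons.inj h).1, ih (List.cons.inj h).2]

theorem append_right_cancel {l m k : NEList X} (h : append l k = append m k) : l = m := by
  apply toList_injective
  have h' := congrArg toList h
  rw [toList_append, toList_append] at h'
  exact List.append_cancel_right h'

end NEList

/-! ### The entwined coalgebra of towers -/

/-- The set `ℕ × {0, 1}`, thought of as two infinite towers standing on the leaves. -/
inductive Tower : Type u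
  | leaf (b : Bool) : Tower
  | up (s : Tower) : Tower

namespace Tower

open NEList

/-- The product `s * t` raises `t` by the number of levels of `s`, and forgets the tower of `s`. -/
def mul : Tower.{u} → Tower.{u} → Tower.{u}
  | leaf _, t => up t
  | up s, t => up (mul s t)

theorem mul_assoc (s t r : Tower.{u}) : mul (mul s t) r = mul s (mul t r) := by
  induction s with
  | leaf b => rfl
  | up s ih => simp only [mul, ih]

/-- The product of a non-empty list. -/
def prod : NEList Tower.{u} → Tower.{u}
  | single s => s
  | cons s l => mul s (prod l)

theorem prod_append (l m : NEList Tower.{u}) : prod (append l m) = mul (prod l) (prod m) := by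
  induction l with
  | single s => rfl
  | cons s l ih => simp only [append, prod, ih, mul_assoc]

theorem prod_flatten (L : NEList (NEList Tower.{u})) :
    prod (flatten L) = prod (NEList.map prod L) := by
  induction L with
  | single l => rfl
  | cons l L ih => simp only [flatten, NEList.map, prod, prod_append, ih]

/-- The path from an element down to its leaf. -/
def path : Tower.{u} → NEList Tower.{u}
  | leaf b => single (leaf b)
  | up s => cons (up s) (path s)

theorem head_path (s : Tower.{u}) : head (path s) = s := by
  cases s <;> rfl

/-- Coassociativity: each suffix of a path is the path of its own first node. -/
theorem map_path_path (s : Tower.{u}) : NEList.map path (path s) = tails (path s) := by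
  induction s with
  | leaf b => rfl
  | up s ih => simp only [path, NEList.map, tails, ih]

/-- The binary case of compatibility: descending from `s * t` first uses up the levels of `s`,
reaches `leaf b * t = up t`, and then continues below at `t`. -/
theorem path_mul (s t : Tower.{u}) :
    path (mul s t) = append (NEList.map (fun r => mul r t) (path s)) (path t) := by
  induction s with
  | leaf b => rfl
  | up s ih => simp only [mul, path, NEList.map, append, ih]

/-- `path_mul` iterated along the list. The later entries that `theta` appends are heads of paths,
that is, the original factors, so `prod` multiplies each node by the product of the remaining
factors. -/
theorem path_prod (l : NEList Tower.{u}) :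
    path (prod l) = NEList.map prod (theta (NEList.map path l)) := by
  induction l with
  | single s => simp only [prod, NEList.map, theta, map_map, map_id']
  | cons s l ih =>
    simp only [prod, NEList.map, theta, map_append, map_map, head_path, map_id', path_mul, ih]

/-- The semigroup of towers as an algebra over the non-empty list monad. -/
def algebra : NEList.monad.{u}.Algebra where
  A := Tower.{u}
  a := ↾prod
  unit := rfl
  assoc := by ext L; exact prod_flatten L

/-- The entwined coalgebra of towers. -/
def coalgebra : NEList.bimonad.{u}.EntwinedCoalgebra where
  A := algebra
  a :=
    { f := ↾path
      h := by ext l; exact (path_prod l).symm }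
  counit := by ext s; exact head_path s
  coassoc := by ext s; exact (map_path_path s).symm

/-- The semigroup of towers is not right cancellative, so it embeds into no free semigroup. -/
theorem isEmpty_comparison_iso (X : Type u) :
    IsEmpty (NEList.bimonad.{u}.comparison.obj X ≅ coalgebra.{u}) := by
  refine ⟨fun i => ?_⟩
  let g : Tower.{u} → NEList X := fun s => i.inv.f.f s
  let f : NEList X → Tower.{u} := fun l => i.hom.f.f l
  -- Of the isomorphism, only the injectivity of the semigroup map `g` matters.
  have hfg (s : Tower.{u}) : f (g s) = s :=
    congrArg (fun k : coalgebra.{u} ⟶ coalgebra.{u} => (k.f.f s : Tower.{u})) i.inv_hom_id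
  -- The algebra-morphism square evaluated at the list `[s, t]`.
  have hg (s t : Tower.{u}) : append (g s) (g t) = g (mul s t) :=
    ConcreteCategory.congr_hom i.inv.f.h (cons s (single t) : NEList Tower.{u})
  -- Both leaves times `leaf true` reduce to `up (leaf true)`; cancel on the right in the free
  -- semigroup.
  have h : g (leaf true) = g (leaf false) :=
    append_right_cancel (k := g (leaf true)) ((hg _ _).trans (hg (leaf false) _).symm)
  have h' := congrArg f h
  rw [hfg, hfg] at h'
  cases h'

end Tower

theorem NEList.not_isEquivalence_comparison :
    ¬ NEList.bimonad.{u}.comparison.IsEquivalence := by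
  intro h
  obtain ⟨X, ⟨i⟩⟩ := h.essSurj.mem_essImage Tower.coalgebra.{u}
  exact (Tower.isEmpty_comparison_iso X).false i

theorem mainTheorem10 :
    ¬ (NEList.bimonad.{u}.comparison :
        Type u ⥤ NEList.bimonad.{u}.EntwinedCoalgebra).IsEquivalence ∧
      ¬ NEList.bimonad.{u}.ConjugateClassificationApplies :=
  ⟨NEList.not_isEquivalence_comparison, fun h => NEList.not_isEquivalence_comparison h.2⟩
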